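/- Let $G$ be a finite group and let $k$ be a commutative Noetherian ring. Let $\mathrm{FI}_G$ be the category whose objects are the finite sets and whose morphisms $S \to T$ are the pairs $(f,c)$ of an injection $f : S \to T$ and an arbitrary map $c : S \to G$, with composition $(f',c')\circ(f,c) = (f'\circ f,\ s \mapsto c'(f(s))\,c(s))$. For a category $\mathcal{D}$, a $\mathcal{D}$-module over $k$ is a covariant functor $V$ from $\mathcal{D}$ to the category of $k$-modules; a submodule of $V$ is a family of $k$-submodules $W(X) \subseteq V(X)$, one for each object $X$, such that $V(\alpha)(W(X)) \subseteq W(Y)$ for every morphism $\alpha : X \to Y$; and $V$ is finitely generated if there is a finite set of elements $v_i \in V(X_i)$ such that no proper submodule of $V$ contains all of them. Then $\mathrm{FI}_G$ is locally Noetherian over $k$: every submodule of a finitely generated $\mathrm{FI}_G$-module over $k$ is itself a finitely generated $\mathrm{FI}_G$-module. The same holds for the skeletal full subcategory of $\mathrm{FI}_G$ whose objects are the standard sets with $n$ elements, $n \ge 0$. -/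

import Mathlib

open CategoryTheory

universe w v u r v₁ u₁

/-- A module over a category `C` with coefficients in `k`: a covariant functor `C ⥤ k-Mod`. -/
abbrev CatModule (k : Type r) [CommRing k] (C : Type u₁) [Category.{v₁} C] :=
  C ⥤ ModuleCat.{w} k

namespace CatModule

section

variable {k : Type r} [CommRing k] {C : Type u₁} [Category.{v₁} C]

/-- A submodule of a `C`-module `V`: a `k`-submodule of each value `V X`, these being carried into
each other by all morphisms of `C`. -/
@[ext]
structure Sub (V : CatModule.{w} k C) where
  obj : ∀ X : C, Submodule k (V.obj X)
  map_mem : ∀ {X Y : C} (f : X ⟶ Y) (x : V.obj X), x ∈ obj X → (V.map f).hom x ∈ obj Y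

/-- A submodule, regarded as a `C`-module in its own right. -/
def Sub.toCatModule {V : CatModule.{w} k C} (W : Sub V) : CatModule.{w} k C where
  obj X := ModuleCat.of k (W.obj X)
  map f := ModuleCat.ofHom ((V.map f).hom.restrict (W.map_mem f))
  map_id X := by
    ext x
    simp
  map_comp f g := by
    ext x
    simp

/-- `V` is generated by a set `S` of its elements (an element being a pair of an object `X` and an
element of `V X`) if the only submodule of `V` containing `S` is `V` itself. -/
def GeneratedBy (V : CatModule.{w} k C) (S : Set (Σ X : C, V.obj X)) : Prop :=
  ∀ N : Sub V, (∀ s ∈ S, s.2 ∈ N.obj s.1) → ∀ X : C, N.obj X = ⊤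

/-- `V` is finitely generated: it is generated by some finite set of its elements. -/
def FinitelyGenerated (V : CatModule.{w} k C) : Prop :=
  ∃ S : Set (Σ X : C, V.obj X), S.Finite ∧ V.GeneratedBy S

end

end CatModule

/-- The category `C` is locally Noetherian over `k`: every submodule of a finitely generated
`C`-module over `k` is finitely generated. -/
def LocallyNoetherianOver (k : Type r) [CommRing k] (C : Type u₁) [Category.{v₁} C] : Prop :=
  ∀ V : CatModule.{w} k C, V.FinitelyGenerated →
    ∀ W : CatModule.Sub V, W.toCatModule.FinitelyGenerated

/-- The objects of the category `FI_G`: finite sets. -/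
structure FIG (G : Type v) : Type (u + 1) where
  carrier : Type u
  [finite : Finite carrier]

namespace FIG

attribute [instance] FIG.finite

/-- A morphism `S ⟶ T` of `FI_G`: an injection `S → T` together with an arbitrary map `S → G`. -/
@[ext]
structure Hom {G : Type v} (S T : FIG.{v, u} G) : Type (max u v) where
  inj : S.carrier ↪ T.carrier
  col : S.carrier → G

/-- Composition in `FI_G`: `(f', c') ∘ (f, c) = (f' ∘ f, s ↦ c' (f s) * c s)`. -/
instance {G : Type v} [Group G] : Category.{max u v} (FIG.{v, u} G) where
  Hom S T := Hom S T
  id S := ⟨Function.Embedding.refl S.carrier, fun _ => 1⟩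
  comp a b := ⟨a.inj.trans b.inj, fun s => b.col (a.inj s) * a.col s⟩
  id_comp a := by
    apply Hom.ext
    · rfl
    · funext s
      exact mul_one _
  comp_id a := by
    apply Hom.ext
    · rfl
    · funext s
      exact one_mul _
  assoc a b c := by
    apply Hom.ext
    · rfl
    · funext s
      exact (mul_assoc _ _ _).symm

/-- The standard object with `n` elements. -/
def std (G : Type v) (n : ℕ) : FIG.{v, 0} G := ⟨Fin n⟩

/-- The skeletal full subcategory of `FI_G`, with the nonnegative integers as objects. -/
abbrev Skel (G : Type v) [Group G] := InducedCategory (FIG.{v, 0} G) (std G)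

end FIG

/-! This is a Gröbner basis argument. Restriction along a full, essentially surjective functor
reduces everything to the skeleton. There, if `V` is generated by a finite `S`, each `V n` is
spanned by finitely many monomials, the images of the generators under morphisms `f : d s ⟶ n`. Such
an `f` is a word of length `n` with letters in a finite alphabet. Order embeddings with trivial
colours insert blanks into words, hence preserve the lexicographic order, and Higman's lemma makes
divisibility through them a well-quasi-order. The leading coefficients of `W` at a monomial form an
ideal of `k`, which grows along divisibility. As `k` is Noetherian, finitely many monomials suffice
to divide any other one with the same ideal, and lifts of generators of their ideals generate `W` by
cancelling leading terms. The monomials need not be linearly independent: `leadIdeal` only asks that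
some element of `W` be congruent to `a • e` modulo smaller monomials. -/

namespace CatModule

/-! ### Finite generation and restriction along functors -/

section

variable {k : Type r} [CommRing k] {C : Type u₁} [Category.{v₁} C] {V : CatModule.{w} k C}

/-- A submodule is finitely generated if finitely many of its elements are contained in no smaller
submodule. -/
def Sub.FG (W : Sub V) : Prop :=
  ∃ S : Set (Σ X : C, V.obj X), S.Finite ∧ (∀ s ∈ S, s.2 ∈ W.obj s.1) ∧
    ∀ N : Sub V, (∀ s ∈ S, s.2 ∈ N.obj s.1) → ∀ X, W.obj X ≤ N.obj X

/-- The image in `V` of a submodule of `W`. -/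
def Sub.mapSubtype (W : Sub V) (N : Sub W.toCatModule) : Sub V where
  obj X := (N.obj X).map (W.obj X).subtype
  map_mem {X Y} f x hx := by
    obtain ⟨y, hy, rfl⟩ := hx
    exact ⟨_, N.map_mem f y hy, rfl⟩

/-- The intersection of a submodule of `V` with `W`, as a submodule of `W`. -/
def Sub.comapSubtype (W : Sub V) (N : Sub V) : Sub W.toCatModule where
  obj X := (N.obj X).comap (W.obj X).subtype
  map_mem f _ hx := N.map_mem f _ hx

/-- The inclusion of the elements of `W` into the elements of `V`. -/
def Sub.incl (W : Sub V) (s : Σ X : C, W.toCatModule.obj X) : Σ X : C, V.obj X :=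
  ⟨s.1, (W.obj s.1).subtype s.2⟩

theorem Sub.incl_injective (W : Sub V) : Function.Injective W.incl := by
  rintro ⟨X, x⟩ ⟨Y, y⟩ h
  obtain ⟨h₁, h₂⟩ := Sigma.mk.inj_iff.1 h
  obtain rfl : X = Y := h₁
  obtain rfl : x = y := Subtype.ext (eq_of_heq h₂)
  rfl

theorem Sub.fg_iff (W : Sub V) : W.FG ↔ W.toCatModule.FinitelyGenerated := by
  constructor
  · rintro ⟨S, hS, hSW, hgen⟩
    refine ⟨W.incl ⁻¹' S, hS.preimage W.incl_injective.injOn, fun N hN X =>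
      eq_top_iff.2 fun (x : W.obj X) _ => ?_⟩
    obtain ⟨y, hy, hyx⟩ := hgen (W.mapSubtype N)
      (fun s hs => ⟨⟨s.2, hSW s hs⟩, hN ⟨s.1, ⟨s.2, hSW s hs⟩⟩ hs, rfl⟩) X x.2
    obtain rfl : y = x := (W.obj X).subtype_injective hyx
    exact hy
  · rintro ⟨S, hS, hgen⟩
    refine ⟨W.incl '' S, hS.image _, ?_, fun N hN X x hx => ?_⟩
    · rintro _ ⟨s, -, rfl⟩
      exact s.2.2
    · have h := hgen (W.comapSubtype N) (fun s hs => hN _ ⟨s, hs, rfl⟩) X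
      let y : W.toCatModule.obj X := (⟨x, hx⟩ : W.obj X)
      have : y ∈ (W.comapSubtype N).obj X := h ▸ Submodule.mem_top
      exact this

theorem map_hom_map_inv {X Y : C} (i : X ≅ Y) (x : V.obj Y) :
    (V.map i.hom).hom ((V.map i.inv).hom x) = x := by
  rw [← ModuleCat.comp_apply, ← V.map_comp, i.inv_hom_id, V.map_id, ModuleCat.id_apply]

/-- The restriction of a submodule along a functor. -/
def Sub.restrict {D : Type*} [Category D] (F : D ⥤ C) (W : Sub V) :
    Sub (V := (F ⋙ V : CatModule.{w} k D)) where
  obj d := W.obj (F.obj d)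
  map_mem f x hx := W.map_mem (F.map f) x hx

/-- The largest submodule of `V` whose restriction along `F` is contained in `N`, provided `F` is
full. -/
def Sub.coextend {D : Type*} [Category D] (F : D ⥤ C)
    (N : Sub (V := (F ⋙ V : CatModule.{w} k D))) : Sub V where
  obj X := ⨅ (d : D) (f : X ⟶ F.obj d), (N.obj d).comap (V.map f).hom
  map_mem {X Y} g x hx := by
    simp only [Submodule.mem_iInf, Submodule.mem_comap] at hx ⊢
    intro d f
    simpa using hx d (g ≫ f)

/-- Generators are moved along isomorphisms to objects in the image of `F`. If `N` contains them,
fullness puts the original ones in `Sub.coextend F N`, which is then everything; evaluating at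
identities gives `N = ⊤`. -/
theorem FinitelyGenerated.comp {D : Type*} [Category D] (F : D ⥤ C) [F.Full] [F.EssSurj]
    (hV : V.FinitelyGenerated) : FinitelyGenerated (F ⋙ V : CatModule.{w} k D) := by
  obtain ⟨S, hS, hgen⟩ := hV
  refine ⟨(fun s : Σ X : C, V.obj X => (⟨F.objPreimage s.1,
    (V.map (F.objObjPreimageIso s.1).inv).hom s.2⟩ : Σ d : D, V.obj (F.obj d))) '' S,
    hS.image _, fun N hN d => eq_top_iff.2 fun x _ => ?_⟩
  have h := hgen (Sub.coextend F N) (fun s hs => ?_) (F.obj d)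
  · have hx : x ∈ (Sub.coextend F N).obj (F.obj d) := h ▸ Submodule.mem_top
    simp only [Sub.coextend, Submodule.mem_iInf, Submodule.mem_comap] at hx
    simpa using hx d (𝟙 _)
  · simp only [Sub.coextend, Submodule.mem_iInf, Submodule.mem_comap]
    intro e f
    obtain ⟨g, hg⟩ := F.map_surjective ((F.objObjPreimageIso s.1).hom ≫ f)
    have := N.map_mem g _ (hN _ ⟨s, hs, rfl⟩)
    rw [Functor.comp_map, hg] at this
    simpa [map_hom_map_inv] using this

theorem Sub.FG.of_restrict {D : Type*} [Category D] (F : D ⥤ C) [F.EssSurj] {W : Sub V}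
    (h : (W.restrict F).FG) : W.FG := by
  obtain ⟨S, hS, hSW, hgen⟩ := h
  refine ⟨(fun s : Σ d : D, V.obj (F.obj d) => (⟨F.obj s.1, s.2⟩ : Σ X : C, V.obj X)) '' S,
    hS.image _, ?_, fun N hN X x hx => ?_⟩
  · rintro _ ⟨s, hs, rfl⟩
    exact hSW s hs
  · have h := hgen (N.restrict F) (fun s hs => hN _ ⟨s, hs, rfl⟩) (F.objPreimage X)
      (W.map_mem (F.objObjPreimageIso X).inv x hx)
    simpa only [map_hom_map_inv] using N.map_mem (F.objObjPreimageIso X).hom _ h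

/-- Local Noetherianity passes along full and essentially surjective functors. -/
theorem _root_.LocallyNoetherianOver.of_functor {D : Type*} [Category D] (F : D ⥤ C) [F.Full]
    [F.EssSurj] (h : LocallyNoetherianOver.{w} k D) : LocallyNoetherianOver.{w} k C := by
  intro V hV W
  have := h (F ⋙ V) (hV.comp F) (W.restrict F)
  exact W.fg_iff.1 (.of_restrict F ((Sub.fg_iff _).2 this))

end

end CatModule

/-! ### Well-quasi-orders -/

/-- A well-quasi-order has a finite basis. -/
theorem WellQuasiOrdered.exists_finset_basis {α : Type*} {R : α → α → Prop}
    (h : WellQuasiOrdered R) : ∃ T : Finset α, ∀ b, ∃ a ∈ T, R a b := by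
  by_contra! H
  obtain ⟨f, -, hf⟩ := exists_seq_of_forall_finset_exists (fun _ : α => True)
    (fun a b => ¬ R a b) (fun s _ => (H s).imp fun b hb => ⟨trivial, hb⟩)
  obtain ⟨m, n, hmn, hR⟩ := h f
  exact hf m n hmn hR

/-- Refining a well-quasi-order by requiring equality of a monotone invariant with values in a
partial order satisfying the ascending chain condition. -/
theorem WellQuasiOrdered.and_eq {α β : Type*} {R : α → α → Prop} [IsPreorder α R]
    (h : WellQuasiOrdered R) [PartialOrder β] [WellFoundedGT β] (J : α → β)
    (hJ : ∀ a b, R a b → J a ≤ J b) : WellQuasiOrdered fun a b => R a b ∧ J a = J b := by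
  intro f
  obtain ⟨g, hg⟩ := h.exists_monotone_subseq f
  -- Along a monotone subsequence the values of `J` ascend, so they stabilise.
  obtain ⟨n, hn⟩ := WellFoundedGT.monotone_chain_condition
    (⟨fun i => J (f (g i)), fun i j hij => hJ _ _ (hg i j hij)⟩ : ℕ →o β)
  exact ⟨g n, g (n + 1), g.strictMono n.lt_succ_self, hg _ _ n.le_succ, hn (n + 1) n.le_succ⟩

/-! ### Leading coefficients and Gröbner bases -/

namespace CatModule

section

variable {k : Type r} [CommRing k] {C : Type u₁} [Category.{v₁} C] {V : CatModule.{w} k C}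
  {M : C → Type*} [∀ X, LinearOrder (M X)] (e : ∀ X, M X → V.obj X)

/-- The divisibility relation on the monomials `e X m`: the second one is the image of the first
under a morphism which sends monomials smaller than the first one to monomials smaller than the
second one. -/
def Divides (p q : Σ X, M X) : Prop :=
  ∃ f : p.1 ⟶ q.1, (V.map f).hom (e p.1 p.2) = e q.1 q.2 ∧
    ∀ m < p.2, ∃ m' < q.2, (V.map f).hom (e p.1 m) = e q.1 m'

instance : IsPreorder (Σ X, M X) (Divides e) where
  refl p := ⟨𝟙 _, by simp, fun m hm => ⟨m, hm, by simp⟩⟩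
  trans := by
    rintro p q s ⟨f, hf, hf'⟩ ⟨g, hg, hg'⟩
    refine ⟨f ≫ g, by simp [hf, hg], fun m hm => ?_⟩
    obtain ⟨m₁, hm₁, h₁⟩ := hf' m hm
    obtain ⟨m₂, hm₂, h₂⟩ := hg' m₁ hm₁
    exact ⟨m₂, hm₂, by simp [h₁, h₂]⟩

/-- The span of the monomials smaller than a given one. -/
def lowerSpan (p : Σ X, M X) : Submodule k (V.obj p.1) :=
  Submodule.span k (e p.1 '' Set.Iio p.2)

variable {e} in
theorem map_mem_lowerSpan {p q : Σ X, M X} {f : p.1 ⟶ q.1}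
    (hf : ∀ m < p.2, ∃ m' < q.2, (V.map f).hom (e p.1 m) = e q.1 m') {y : V.obj p.1}
    (hy : y ∈ lowerSpan e p) : (V.map f).hom y ∈ lowerSpan e q := by
  have : lowerSpan e p ≤ (lowerSpan e q).comap (V.map f).hom := by
    refine Submodule.span_le.2 ?_
    rintro _ ⟨m, hm, rfl⟩
    obtain ⟨m', hm', h⟩ := hf m hm
    rw [SetLike.mem_coe, Submodule.mem_comap, h]
    exact Submodule.subset_span ⟨m', hm', rfl⟩
  exact this hy

/-- The ideal of leading coefficients at a monomial of the elements of `W`. -/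
def leadIdeal (W : Sub V) (p : Σ X, M X) : Ideal k where
  carrier := {a | ∃ x ∈ W.obj p.1, x - a • e p.1 p.2 ∈ lowerSpan e p}
  zero_mem' := ⟨0, zero_mem _, by simp⟩
  add_mem' := by
    rintro a b ⟨x, hx, hx'⟩ ⟨y, hy, hy'⟩
    refine ⟨x + y, add_mem hx hy, ?_⟩
    convert add_mem hx' hy' using 1
    module
  smul_mem' := by
    rintro c a ⟨x, hx, hx'⟩
    refine ⟨c • x, Submodule.smul_mem _ _ hx, ?_⟩
    convert Submodule.smul_mem _ c hx' using 1
    rw [smul_sub, smul_eq_mul, mul_smul]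

theorem leadIdeal_mono (W : Sub V) {p q : Σ X, M X} (h : Divides e p q) :
    leadIdeal e W p ≤ leadIdeal e W q := by
  obtain ⟨f, hf, hf'⟩ := h
  rintro a ⟨x, hx, hx'⟩
  refine ⟨(V.map f).hom x, W.map_mem f x hx, ?_⟩
  simpa [hf] using map_mem_lowerSpan hf' hx'

/-- Finitely many elements of `W` realize all leading coefficients at a monomial. -/
theorem exists_finite_leadIdeal [IsNoetherianRing k] (W : Sub V) (p : Σ X, M X) :
    ∃ S : Set (V.obj p.1), S.Finite ∧ (∀ x ∈ S, x ∈ W.obj p.1) ∧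
      ∀ a ∈ leadIdeal e W p, ∃ x ∈ Submodule.span k S, x - a • e p.1 p.2 ∈ lowerSpan e p := by
  obtain ⟨A, hA⟩ := IsNoetherian.noetherian (leadIdeal e W p)
  have hmem : ∀ a : A, ∃ x ∈ W.obj p.1, x - (a : k) • e p.1 p.2 ∈ lowerSpan e p :=
    fun a => (hA ▸ Submodule.subset_span a.2 : (a : k) ∈ leadIdeal e W p)
  choose x hxW hx using hmem
  refine ⟨Set.range x, Set.finite_range x, by rintro _ ⟨a, rfl⟩; exact hxW a, fun a ha => ?_⟩
  rw [← hA] at ha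
  induction ha using Submodule.span_induction with
  | mem a ha => exact ⟨x ⟨a, ha⟩, Submodule.subset_span ⟨_, rfl⟩, hx ⟨a, ha⟩⟩
  | zero => exact ⟨0, zero_mem _, by simp⟩
  | add a b _ _ iha ihb =>
    obtain ⟨y, hy, hy'⟩ := iha
    obtain ⟨z, hz, hz'⟩ := ihb
    refine ⟨y + z, add_mem hy hz, ?_⟩
    convert add_mem hy' hz' using 1
    module
  | smul c a _ iha =>
    obtain ⟨y, hy, hy'⟩ := iha
    refine ⟨c • y, Submodule.smul_mem _ _ hy, ?_⟩
    convert Submodule.smul_mem _ c hy' using 1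
    rw [smul_sub, smul_eq_mul, mul_smul]

/-- To show that `W` is contained in `N`, it suffices to cancel leading terms of elements of `W` by
elements of `W` and `N`. -/
theorem le_of_forall_cancel [∀ X, Finite (M X)] (hspan : ∀ X, Submodule.span k (Set.range (e X)) = ⊤)
    {W N : Sub V} (h : ∀ p : Σ X, M X, ∀ a ∈ leadIdeal e W p,
      ∃ x ∈ W.obj p.1, x ∈ N.obj p.1 ∧ x - a • e p.1 p.2 ∈ lowerSpan e p) (X : C) :
    W.obj X ≤ N.obj X := by
  -- Induction on a lower set supporting `x`: cancelling the term at its maximum `m` leaves an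
  -- element supported on `Set.Iio m`.
  have key : ∀ T : Set (M X), IsLowerSet T → ∀ x ∈ W.obj X,
      x ∈ Submodule.span k (e X '' T) → x ∈ N.obj X := by
    intro T
    induction T using WellFoundedLT.induction with
    | ind T ih =>
      intro hT x hxW hx
      rcases T.eq_empty_or_nonempty with rfl | hne
      · obtain rfl : x = 0 := by simpa using hx
        exact zero_mem _
      obtain ⟨m, hmT, hm⟩ := Set.exists_max_image T id T.toFinite hne
      have hTm : T = insert m (Set.Iio m) := by
        ext t
        simp only [Set.mem_insert_iff, Set.mem_Iio, ← le_iff_eq_or_lt]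
        exact ⟨fun ht => hm t ht, fun ht => hT ht hmT⟩
      rw [hTm, Set.image_insert_eq, Submodule.mem_span_insert] at hx
      obtain ⟨a, z, hz, rfl⟩ := hx
      obtain ⟨y, hyW, hyN, hy⟩ := h ⟨X, m⟩ a ⟨_, hxW, by simpa [lowerSpan] using hz⟩
      have hlt : Set.Iio m < T := by
        rw [hTm]
        exact Set.ssubset_insert (by simp)
      have := ih _ hlt (isLowerSet_Iio m) _ (sub_mem hxW hyW) (by
        convert sub_mem hz hy using 1
        abel)
      simpa using add_mem this hyN
  intro x hx
  exact key Set.univ isLowerSet_univ x hx (by rw [Set.image_univ, hspan]; trivial)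

/-- If `V` is spanned by monomials which are well-quasi-ordered by divisibility, then all its
submodules are finitely generated. -/
theorem Sub.fg_of_wellQuasiOrdered [IsNoetherianRing k] [∀ X, Finite (M X)]
    (hspan : ∀ X, Submodule.span k (Set.range (e X)) = ⊤) (hwqo : WellQuasiOrdered (Divides e))
    (W : Sub V) : W.FG := by
  obtain ⟨T, hT⟩ := (hwqo.and_eq (leadIdeal e W)
    (fun _ _ => leadIdeal_mono e W)).exists_finset_basis
  choose S hSfin hSW hS using exists_finite_leadIdeal e W
  refine ⟨⋃ p ∈ T, Sigma.mk p.1 '' S p, T.finite_toSet.biUnion fun p _ => (hSfin p).image _, ?_,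
    fun N hN X => le_of_forall_cancel e hspan (fun q a ha => ?_) X⟩
  · simp only [Set.mem_iUnion]
    rintro _ ⟨p, -, x, hx, rfl⟩
    exact hSW p x hx
  -- Equality of the ideals makes `a` already a leading coefficient at `p`; a realizing element
  -- there is pushed along `f`.
  · obtain ⟨p, hpT, ⟨f, hf, hf'⟩, hpq⟩ := hT q
    obtain ⟨x, hx, hxa⟩ := hS p a (hpq ▸ ha)
    have hxW : x ∈ W.obj p.1 := Submodule.span_le.2 (hSW p) hx
    have hxN : x ∈ N.obj p.1 := Submodule.span_le.2 (fun y hy => hN ⟨p.1, y⟩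
      (Set.mem_biUnion hpT ⟨y, hy, rfl⟩)) hx
    refine ⟨(V.map f).hom x, W.map_mem f x hxW, N.map_mem f x hxN, ?_⟩
    simpa [hf] using map_mem_lowerSpan hf' hxa

/-- The submodule of `V` spanned by the images of the elements of a set. -/
def spanSub (S : Set (Σ X : C, V.obj X)) : Sub V where
  obj X := Submodule.span k (Set.range fun m : Σ s : S, (s.1.1 ⟶ X) => (V.map m.2).hom m.1.1.2)
  map_mem {X Y} f x hx := by
    induction hx using Submodule.span_induction with
    | mem x hx =>
      obtain ⟨m, rfl⟩ := hx
      exact Submodule.subset_span ⟨⟨m.1, m.2 ≫ f⟩, by simp⟩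
    | zero => simp
    | add x y _ _ hx hy => simpa using add_mem hx hy
    | smul c x _ hx => simpa using Submodule.smul_mem _ c hx

theorem GeneratedBy.span_eq_top {S : Set (Σ X : C, V.obj X)} (h : V.GeneratedBy S) (X : C) :
    Submodule.span k (Set.range fun m : Σ s : S, (s.1.1 ⟶ X) => (V.map m.2).hom m.1.1.2) = ⊤ :=
  h (spanSub S) (fun s hs => Submodule.subset_span ⟨⟨⟨s, hs⟩, 𝟙 _⟩, by simp⟩) X

end

end CatModule

/-! ### Words and Higman's lemma for the skeleton -/

namespace FIG

variable {G : Type v} [Group G]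

/-- The standard objects of `FI_G`, in any universe. -/
def skelFunctor (G : Type v) [Group G] : Skel G ⥤ FIG.{v, u} G where
  obj n := ⟨ULift.{u} (Fin n)⟩
  map f := ⟨⟨fun i => ⟨f.hom.inj i.down⟩, fun _ _ h =>
    ULift.ext _ _ (f.hom.inj.injective (ULift.up.inj h))⟩, fun i => f.hom.col i.down⟩
  map_id _ := rfl
  map_comp _ _ := rfl

instance : (skelFunctor.{v, u} G).Full where
  map_surjective f := ⟨⟨⟨⟨fun i => (f.inj ⟨i⟩).down, fun _ _ h =>
    ULift.up.inj (f.inj.injective (ULift.ext _ _ h))⟩, fun i => f.col ⟨i⟩⟩⟩, rfl⟩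

/-- A bijection gives an isomorphism in `FI_G`. -/
def isoOfEquiv {S T : FIG.{v, u} G} (f : S.carrier ≃ T.carrier) : S ≅ T where
  hom := ⟨f.toEmbedding, fun _ => 1⟩
  inv := ⟨f.symm.toEmbedding, fun _ => 1⟩
  hom_inv_id := Hom.ext (by ext x; exact f.symm_apply_apply x) (by ext x; exact mul_one 1)
  inv_hom_id := Hom.ext (by ext x; exact f.apply_symm_apply x) (by ext x; exact mul_one 1)

instance : (skelFunctor.{v, u} G).EssSurj where
  mem_essImage T := by
    obtain ⟨n, ⟨f⟩⟩ := Finite.exists_equiv_fin T.carrier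
    exact ⟨(n : ℕ), ⟨isoOfEquiv (Equiv.ulift.trans f.symm)⟩⟩

/-- A finite set of objects of the skeletal category gives the alphabet consisting of a blank and of
the pairs of an element of one of these objects and an element of `G`. -/
abbrev Letter (G : Type v) {S : Type*} (d : S → ℕ) := Option (Σ s : S, Fin (d s) × G)

open Classical in
/-- The word of length `n` describing a morphism `d s ⟶ n`: the letter at the position `j` is the
preimage of `j`, with its colour. -/
noncomputable def word {S : Type*} (d : S → Skel G) {n : Skel G} (m : Σ s, (d s ⟶ n)) (j : Fin n) :
    Letter G d :=
  if h : ∃ i : Fin (d m.1), m.2.hom.inj i = j then some ⟨m.1, h.choose, m.2.hom.col h.choose⟩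
  else none

section

variable {S : Type*} {d : S → Skel G} {n : Skel G}

theorem word_apply (m : Σ s, (d s ⟶ n)) (i : Fin (d m.1)) :
    word d m (m.2.hom.inj i) = some ⟨m.1, i, m.2.hom.col i⟩ := by
  have h : ∃ i' : Fin (d m.1), m.2.hom.inj i' = m.2.hom.inj i := ⟨i, rfl⟩
  have : h.choose = i := m.2.hom.inj.injective h.choose_spec
  refine (dif_pos h).trans ?_
  rw [this]

theorem word_eq_none {m : Σ s, (d s ⟶ n)} {j : Fin n}
    (h : ∀ i : Fin (d m.1), m.2.hom.inj i ≠ j) : word d m j = none :=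
  dif_neg (by simpa using h)

theorem word_eq_some {s : S} {f : d s ⟶ n} {j : Fin n} {i : Fin (d s)} {g : G}
    (h : word d ⟨s, f⟩ j = some ⟨s, i, g⟩) : f.hom.inj i = j ∧ f.hom.col i = g := by
  by_cases hj : ∃ i' : Fin (d s), f.hom.inj i' = j
  · obtain ⟨i', rfl⟩ := hj
    have := (word_apply ⟨s, f⟩ i').symm.trans h
    simp only [Option.some.injEq, Sigma.mk.injEq, heq_eq_eq, true_and, Prod.mk.injEq] at this
    obtain ⟨rfl, rfl⟩ := this
    exact ⟨rfl, rfl⟩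
  · rw [word_eq_none (by simpa using hj)] at h
    cases h

/-- The morphism given by an order embedding, with trivial colours. -/
def ofOrderEmb {n n' : Skel G} (ε : Fin n ↪o Fin n') : n ⟶ n' := ⟨⟨ε.toEmbedding, fun _ => 1⟩⟩

theorem word_comp_ofOrderEmb {n' : Skel G} (m : Σ s, (d s ⟶ n)) (ε : Fin n ↪o Fin n') (j : Fin n) :
    word d ⟨m.1, m.2 ≫ ofOrderEmb ε⟩ (ε j) = word d m j := by
  by_cases hj : ∃ i : Fin (d m.1), m.2.hom.inj i = j
  · obtain ⟨i, rfl⟩ := hj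
    rw [word_apply]
    refine (word_apply ⟨m.1, m.2 ≫ ofOrderEmb ε⟩ i).trans ?_
    change some (⟨m.1, i, 1 * m.2.hom.col i⟩ : Σ s : S, Fin (d s) × G) = _
    rw [one_mul]
  · push Not at hj
    rw [word_eq_none hj]
    exact word_eq_none fun i hi => hj i (ε.injective hi)

theorem word_comp_ofOrderEmb_of_notMem {n' : Skel G} (m : Σ s, (d s ⟶ n)) (ε : Fin n ↪o Fin n')
    {j : Fin n'} (hj : j ∉ Set.range ε) : word d ⟨m.1, m.2 ≫ ofOrderEmb ε⟩ j = none :=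
  word_eq_none fun i hi => hj ⟨m.2.hom.inj i, hi⟩

/-- A morphism is recovered by any word containing its word as a subword. -/
theorem comp_ofOrderEmb_eq {n' : Skel G} {s : S} {f : d s ⟶ n} {f' : d s ⟶ n'}
    (ε : Fin n ↪o Fin n') (h : ∀ j, word d ⟨s, f⟩ j = word d ⟨s, f'⟩ (ε j)) :
    f ≫ ofOrderEmb ε = f' := by
  have key : ∀ i : Fin (d s), f'.hom.inj i = ε (f.hom.inj i) ∧ f'.hom.col i = f.hom.col i :=
    fun i => word_eq_some ((h _).symm.trans (word_apply ⟨s, f⟩ i))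
  refine InducedCategory.hom_ext (Hom.ext ?_ ?_)
  · refine Function.Embedding.ext fun i => (key i).1.symm
  · funext i
    exact (one_mul _).trans (key i).2.symm

/-- The word of a morphism, along with the index of its source. -/
noncomputable def lexWord (m : Σ s, (d s ⟶ n)) : S ×ₗ Lex (Fin n → Letter G d) :=
  toLex (m.1, toLex (word d m))

theorem lexWord_injective : Function.Injective (lexWord (d := d) (n := n)) := by
  rintro ⟨s, f⟩ ⟨s', f'⟩ h
  obtain ⟨rfl, hw⟩ := Prod.mk_inj.1 (toLex.injective h)
  have hw' : word d ⟨s, f⟩ = word d ⟨s, f'⟩ := toLex.injective hw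
  rw [← comp_ofOrderEmb_eq (RelEmbedding.refl _) (congrFun hw'),
    comp_ofOrderEmb_eq (f' := f) (RelEmbedding.refl _) fun _ => rfl]

/-- Both words receive blanks at the same positions, those outside the range of `ε`, so their first
difference moves from `j` to `ε j`. -/
theorem lexWord_comp_lt [LinearOrder S] [LinearOrder (Letter G d)] {n' : Skel G}
    {m m' : Σ s, (d s ⟶ n)} (ε : Fin n ↪o Fin n') (h : lexWord m < lexWord m') :
    lexWord (d := d) ⟨m.1, m.2 ≫ ofOrderEmb ε⟩ < lexWord ⟨m'.1, m'.2 ≫ ofOrderEmb ε⟩ := by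
  rcases Prod.Lex.toLex_lt_toLex.1 h with h | ⟨h₁, j, hj, hlt⟩
  · exact Prod.Lex.toLex_lt_toLex.2 (Or.inl h)
  refine Prod.Lex.toLex_lt_toLex.2 (Or.inr ⟨h₁, ε j, fun t ht => ?_, ?_⟩)
  · change word d _ t = word d _ t
    by_cases hr : t ∈ Set.range ε
    · obtain ⟨t, rfl⟩ := hr
      rw [word_comp_ofOrderEmb, word_comp_ofOrderEmb]
      exact hj t (ε.lt_iff_lt.1 ht)
    · rw [word_comp_ofOrderEmb_of_notMem _ _ hr, word_comp_ofOrderEmb_of_notMem _ _ hr]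
  · change word d _ (ε j) < word d _ (ε j)
    rw [word_comp_ofOrderEmb, word_comp_ofOrderEmb]
    exact hlt

instance [Finite G] (n n' : Skel G) : Finite (n ⟶ n') := by
  refine Finite.of_injective
    (fun f : n ⟶ n' => ((f.hom.inj, f.hom.col) : (Fin n ↪ Fin n') × (Fin n → G)))
    fun f f' h => InducedCategory.hom_ext (Hom.ext (Prod.mk_inj.1 h).1 (Prod.mk_inj.1 h).2)

/-- **Higman's lemma** for morphisms from finitely many objects. -/
theorem exists_orderEmb_comp_eq [Finite G] [Finite S] (p : ℕ → Σ n : Skel G, Σ s, (d s ⟶ n)) :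
    ∃ a b : ℕ, a < b ∧ ∃ ε : Fin (p a).1 ↪o Fin (p b).1,
      (⟨(p a).2.1, (p a).2.2 ≫ ofOrderEmb ε⟩ : Σ s, (d s ⟶ (p b).1)) = (p b).2 := by
  have hl := Set.PartiallyWellOrderedOn.partiallyWellOrderedOn_sublistForall₂
    (α := Letter G d) (· = ·) (s := Set.univ) Set.finite_univ.partiallyWellOrderedOn
  have hl' : WellQuasiOrdered (List.SublistForall₂ (· = · : Letter G d → Letter G d → Prop)) := by
    simpa [Set.partiallyWellOrderedOn_univ_iff] using hl
  -- The source is recorded separately, since an empty source leaves only blanks in the word.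
  obtain ⟨a, b, hab, hs, hw⟩ := (Finite.wellQuasiOrdered (α := S) (· = ·)).prod hl'
    fun a => ((p a).2.1, List.ofFn (word d (p a).2))
  refine ⟨a, b, hab, ?_⟩
  generalize p a = pa at *
  generalize p b = pb at *
  obtain ⟨n, s, f⟩ := pa
  obtain ⟨n', s', f'⟩ := pb
  obtain rfl : s = s' := hs
  obtain ⟨l, hl₁, hl₂⟩ := List.sublistForall₂_iff.1 hw
  rw [List.forall₂_eq_eq_eq] at hl₁
  obtain rfl := hl₁
  obtain ⟨ε, hε⟩ := List.sublist_iff_exists_fin_orderEmbedding_get_eq.1 hl₂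
  let ε' : Fin n ↪o Fin n' :=
    ((Fin.castOrderIso (List.length_ofFn (f := word d ⟨s, f⟩))).symm.toOrderEmbedding.trans ε).trans
      (Fin.castOrderIso (List.length_ofFn (f := word d ⟨s, f'⟩))).toOrderEmbedding
  refine ⟨ε', ?_⟩
  change (⟨s, f ≫ ofOrderEmb ε'⟩ : Σ s, (d s ⟶ n')) = ⟨s, f'⟩
  rw [comp_ofOrderEmb_eq ε' fun j => ?_]
  have := hε (Fin.cast (List.length_ofFn (f := word d ⟨s, f⟩)).symm j)
  simp only [List.get_ofFn] at this
  exact this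

end

theorem locallyNoetherianOver_skel [Finite G] (k : Type r) [CommRing k] [IsNoetherianRing k] :
    LocallyNoetherianOver.{w} k (Skel G) := by
  rintro V ⟨S, hS, hgen⟩ W
  have : Finite S := hS
  let d : S → Skel G := fun s => s.1.1
  -- Any linear orders on the sources and the letters would do.
  let : LinearOrder S := IsWellOrder.linearOrder WellOrderingRel
  let : LinearOrder (Letter G d) := IsWellOrder.linearOrder WellOrderingRel
  let (n : Skel G) : LinearOrder (Σ s : S, (d s ⟶ n)) := LinearOrder.lift' lexWord lexWord_injective
  refine W.fg_iff.1 (CatModule.Sub.fg_of_wellQuasiOrdered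
    (fun n (m : Σ s : S, (d s ⟶ n)) => (V.map m.2).hom m.1.1.2) hgen.span_eq_top (fun p => ?_) W)
  obtain ⟨a, b, hab, ε, hε⟩ := exists_orderEmb_comp_eq p
  refine ⟨a, b, hab, ofOrderEmb ε, ?_, fun m hm => ⟨⟨m.1, m.2 ≫ ofOrderEmb ε⟩, ?_, ?_⟩⟩
  · rw [← hε]
    simp
  · rw [← hε]
    exact lexWord_comp_lt ε hm
  · simp

end FIG

theorem theorem2p3 (G : Type v) [Group G] [Finite G] (k : Type r) [CommRing k]
    [IsNoetherianRing k] :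
    LocallyNoetherianOver.{w} k (FIG.{v, u} G) ∧ LocallyNoetherianOver.{w} k (FIG.Skel G) :=
  ⟨.of_functor (FIG.skelFunctor G) (FIG.locallyNoetherianOver_skel k),
    FIG.locallyNoetherianOver_skel k⟩
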